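/- Let $(X,d)$ be a metric space and let $\phi:X\to(-\infty,+\infty]$ be proper and lower semicontinuous, with $\mathrm{Dom}\,\phi=\{\phi<+\infty\}\neq\emptyset$. Definitions. * A set $D\subset X$ is an *approximate length subset* if for all $x_0,x_1\in D$ and $\varepsilon\in(0,1)$ there is $x\in D$ with $d^2(x_0,x)+d^2(x,x_1)\le \tfrac12 d^2(x_0,x_1)(1+\varepsilon^2/4)$. * The *metric slope* $|\partial\phi|(x)\in[0,+\infty]$ is $+\infty$ if $x\notin\mathrm{Dom}\,\phi$, is $0$ if $x\in\mathrm{Dom}\,\phi$ is isolated, and is $\limsup_{y\to x}\frac{(\phi(x)-\phi(y))^+}{d(x,y)}$ otherwise. * Let $\lambda\in\mathbb R$. A *solution of $\mathrm{EVI}_\lambda$* is a continuous curve $u:(0,+\infty)\to\mathrm{Dom}\,\phi$ such that $\frac12\frac{d}{dt}^{\!+}d^2(u_t,v)+\frac\lambda2 d^2(u_t,v)\le\phi(v)-\phi(u_t)$ for all $t>0$ and $v\in\mathrm{Dom}\,\phi$, where $\frac{d}{dt}^{\!+}$ is the upper right Dini derivative. An *$\mathrm{EVI}_\lambda$-gradient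 flow of $\phi$ in $D\subset\overline{\mathrm{Dom}\,\phi}$* is a family of continuous maps $\mathsf S_t:D\to D$, $t\ge0$, such that for every $u_0\in D$: $\mathsf S_{t+h}(u_0)=\mathsf S_h(\mathsf S_t(u_0))$ for all $t,h\ge0$; $\lim_{t\downarrow0}\mathsf S_t(u_0)=\mathsf S_0(u_0)=u_0$; and $t\mapsto\mathsf S_t(u_0)$ is a solution of $\mathrm{EVI}_\lambda$. * Let $\tau>0$, $\eta\ge0$. A *$(\tau,\eta)$-discrete (Ekeland-relaxed) Minimizing Movement* is a sequence $(U^n)_{n\ge0}$ in $\mathrm{Dom}\,\phi$ such that for every $n\ge1$ $$\tfrac1{2\tau}d^2(U^n,U^{n-1})+\phi(U^n)\le\tfrac1{2\tau}d^2(V,U^{n-1})+\phi(V)+\tfrac\eta2 d(U^n,U^{n-1})\,d(V,U^n)\quad\text{for all }V\in X,$$ $$\tfrac1{2\tau}d^2(U^n,U^{n-1})+\phi(U^n)\le\phi(U^{n-1}).$$ Its piecewise constant interpolant is $\bar U(t)=U^n$ for $t\in((n-1)\tau,n\tau]$, $\bar U(0)=U^0$. Set $\gamma:=2\eta-3\lambda$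 and $t_\tau:=\min\{k\tau:k\in\mathbb N,\ k\tau\ge t\}$. Corollary 5.6 (Error estimate for the Minimizing Movement scheme). Suppose that $\mathrm{Dom}\,\phi$ is an approximate length subset of $X$ and that, for some $\lambda\le0$, there is an $\mathrm{EVI}_\lambda$-gradient flow $(\mathsf S_t)_{t\ge0}$ of $\phi$ in $\overline{\mathrm{Dom}\,\phi}$. (1) Let $\tau>0$ and $\eta\ge0$ satisfy $4\gamma\tau\le1$, and let $(U^n)$ be a $(\tau,\eta)$-discrete Minimizing Movement. Then for all $u_0\in\overline{\mathrm{Dom}\,\phi}$ and all $t>0$ $$d(\mathsf S_t(u_0),\bar U(t))\le e^{-\lambda t}d(u_0,U^0)+\big(\sqrt{\tau t_\tau}+t_\tau-t\big)e^{\gamma t_\tau}\,|\partial\phi|(U^0),$$ where the right-hand side is $+\infty$ if $|\partial\phi|(U^0)=+\infty$. (2) In particular, if $\lambda=0$, then for every $t>0$, every integer $n\ge1$ and every $(t/n,0)$-discrete Minimizing Movement $(U^k)$ with $U^0=u_0$, $$d(\mathsf S_t(u_0),U^n)\le\frac{t}{\sqrt n}\,|\partial\phi|(u_0).$$ -/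

import Mathlib

open Filter Topology

namespace MetricEVI

section
variable {X : Type*} [MetricSpace X]

/-- The domain `Dom φ = {φ < +∞}` of a functional `φ : X → (-∞, +∞]`. The functional takes values
in `EReal`; that it never takes the value `-∞` is a separate hypothesis (see `IsSystem`). -/
def effDom (φ : X → EReal) : Set X := {x | φ x < ⊤}

/-- `(X, d, φ)` is a metric-functional system: `φ : X → (-∞, +∞]` is proper and lower
semicontinuous. -/
structure IsSystem (φ : X → EReal) : Prop where
  ne_bot : ∀ x, φ x ≠ ⊥
  proper : (effDom φ).Nonempty
  lsc : LowerSemicontinuous φ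

/-- `x` is a `(θ, ε)`-intermediate point between `x₀` and `x₁`. -/
def IsIntermediatePoint (θ ε : ℝ) (x₀ x₁ x : X) : Prop :=
  dist x₀ x ^ 2 / θ + dist x x₁ ^ 2 / (1 - θ) ≤ dist x₀ x₁ ^ 2 * (1 + ε ^ 2 * (θ * (1 - θ)))

/-- `D` is an approximate length subset: any two of its points have `ε`-midpoints in `D`, for
every `ε ∈ (0, 1)`. -/
def IsApproxLength (D : Set X) : Prop :=
  ∀ x₀ ∈ D, ∀ x₁ ∈ D, ∀ ε : ℝ, 0 < ε → ε < 1 → ∃ x ∈ D, IsIntermediatePoint (1 / 2) ε x₀ x₁ x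

open Classical in
/-- The metric slope `|∂φ|(x) ∈ [0, +∞]`: it is `+∞` outside `Dom φ`, and otherwise the upper limit
of `(φ(x) - φ(y))⁺ / d(x, y)` as `y → x`, `y ≠ x`. At an isolated point `𝓝[≠] x = ⊥`, and the upper
limit is then `0` in `[0, +∞]`. -/
noncomputable def slope (φ : X → EReal) (x : X) : ENNReal :=
  if φ x < ⊤ then limsup (fun y => (φ x - φ y).toENNReal / edist x y) (𝓝[≠] x) else ⊤

/-- The upper right Dini derivative of a real function, with values in `[-∞, +∞]`. -/
noncomputable def upperRightDeriv (f : ℝ → ℝ) (t : ℝ) : EReal :=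
  limsup (fun h : ℝ => (((f (t + h) - f t) / h : ℝ) : EReal)) (𝓝[>] 0)

/-- A solution of the evolution variational inequality with parameter `lam`: a continuous curve
`u : (0, +∞) → Dom φ` (only the values of `u` on `(0, +∞)` matter) satisfying the inequality at every
time `t > 0` and for every test point `v ∈ Dom φ`. -/
structure IsEVISolution (φ : X → EReal) (lam : ℝ) (u : ℝ → X) : Prop where
  cont : ContinuousOn u (Set.Ioi 0)
  mem : ∀ t : ℝ, 0 < t → u t ∈ effDom φ
  evi : ∀ t : ℝ, 0 < t → ∀ v ∈ effDom φ,
    ((1 / 2 : ℝ) : EReal) * upperRightDeriv (fun s => dist (u s) v ^ 2) t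
      + ((lam / 2 * dist (u t) v ^ 2 : ℝ) : EReal) ≤ φ v - φ (u t)

/-- `S` is an `EVI`-gradient flow of `φ` in `D ⊆ closure (Dom φ)`: a family of continuous maps
`S t : D → D`, `t ≥ 0` (only the values for `t ≥ 0` and at points of `D` matter), with the semigroup
property, continuous at `t = 0`, whose trajectories solve the evolution variational inequality. -/
structure IsEVIFlow (φ : X → EReal) (lam : ℝ) (D : Set X) (S : ℝ → X → X) : Prop where
  subset : D ⊆ closure (effDom φ)
  mapsTo : ∀ t : ℝ, 0 ≤ t → Set.MapsTo (S t) D D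
  cont : ∀ t : ℝ, 0 ≤ t → ContinuousOn (S t) D
  semigroup : ∀ u₀ ∈ D, ∀ t h : ℝ, 0 ≤ t → 0 ≤ h → S (t + h) u₀ = S h (S t u₀)
  zero : ∀ u₀ ∈ D, S 0 u₀ = u₀
  tendsto : ∀ u₀ ∈ D, Tendsto (fun t => S t u₀) (𝓝[>] 0) (𝓝 u₀)
  solution : ∀ u₀ ∈ D, IsEVISolution φ lam (fun t => S t u₀)

/-- The Moreau-Yosida-Ekeland resolvent of `x`. -/
def resolvent (φ : X → EReal) (τ η : ℝ) (x : X) : Set X :=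
  {z | z ∈ effDom φ ∧
    (∀ y : X, ((1 / (2 * τ) * dist x z ^ 2 : ℝ) : EReal) + φ z ≤
      ((1 / (2 * τ) * dist x y ^ 2 : ℝ) : EReal) + φ y + ((η / 2 * dist x z * dist y z : ℝ) : EReal)) ∧
    ((1 / (2 * τ) * dist x z ^ 2 : ℝ) : EReal) + φ z ≤ φ x}

/-- `U` is a `(τ, η)`-discrete (Ekeland-relaxed) Minimizing Movement; it starts from `U 0`. -/
structure IsMinimizingMovement (φ : X → EReal) (τ η : ℝ) (U : ℕ → X) : Prop where
  mem : ∀ n, U n ∈ effDom φ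
  step : ∀ n, U (n + 1) ∈ resolvent φ τ η (U n)

end

/-- `t_τ`, the least natural multiple of `τ` that is at least `t` (see `isLeast_gridCeil`). -/
noncomputable def gridCeil (τ t : ℝ) : ℝ := (⌈t / τ⌉₊ : ℝ) * τ

/-- The piecewise constant interpolant: it equals `U n` on `((n - 1) τ, n τ]` and `U 0` at `0`
(see `interpolant_eq` and `interpolant_zero`). -/
noncomputable def interpolant {X : Type*} (τ : ℝ) (U : ℕ → X) (t : ℝ) : X := U ⌈t / τ⌉₊

theorem isLeast_gridCeil {τ : ℝ} (hτ : 0 < τ) (t : ℝ) :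
    IsLeast {s : ℝ | ∃ k : ℕ, s = k * τ ∧ t ≤ s} (gridCeil τ t) := by
  refine ⟨⟨_, rfl, (div_le_iff₀ hτ).1 (Nat.le_ceil _)⟩, ?_⟩
  rintro s ⟨k, rfl, hk⟩
  have h : ⌈t / τ⌉₊ ≤ k := Nat.ceil_le.2 ((div_le_iff₀ hτ).2 hk)
  exact mul_le_mul_of_nonneg_right (by exact_mod_cast h) hτ.le

theorem interpolant_eq {X : Type*} {τ : ℝ} (hτ : 0 < τ) (U : ℕ → X) {n : ℕ} {t : ℝ}
    (h₀ : 0 < t) (h₁ : ((n : ℝ) - 1) * τ < t) (h₂ : t ≤ n * τ) : interpolant τ U t = U n := by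
  have hn : n ≠ 0 := by
    rintro rfl
    simp at h₂
    linarith
  have h : ⌈t / τ⌉₊ = n := by
    rw [Nat.ceil_eq_iff hn, Nat.cast_pred (Nat.pos_of_ne_zero hn)]
    exact ⟨(lt_div_iff₀ hτ).2 h₁, (div_le_iff₀ hτ).2 h₂⟩
  rw [interpolant, h]

theorem interpolant_zero {X : Type*} (τ : ℝ) (U : ℕ → X) : interpolant τ U 0 = U 0 := by
  simp [interpolant]

end MetricEVI

/-! Write `μ = -λ ≥ 0` and `γ = 2η + 3μ`. The EVI supplies two global facts about the flow: it
expands distances by at most `e^{μt}` (`dist_le`), and the local slope at `x` controls `φ x - φ y`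
for every `y`, up to `μ/2 d²` (`energy_sub_le`), so the flow leaves `x` at speed about `|∂φ|(x)`.

Flowing approximate midpoints for a short time shows that `φ` is almost `(-μ)`-convex
(`exists_almost_midpoint`). Testing the minimality of `u` against almost geodesic points near `u`
then doubles the naive dissipation, from `d²(x,u)/(2τ)` to nearly `d²(x,u)/τ`
(`energy_sub_resolvent_ge`). Inserted in the EVI with test point `u`, this gives the local estimate
`dist_sq_resolvent_le`: `d²(S_τ x, u)` is at most `τ²` times the decrease, up to exponential
factors, from `G²` to `g'²`, where `G` bounds the slope at `x` and `g' = (1/τ + η/2) d(x,u)` bounds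
the slope at `u` (`slope_resolvent_le`).

These decreases telescope. Contractivity transports the local errors to the final time, and
Cauchy-Schwarz over `n` steps costs only `√n`, so the error at time `nτ` is of order `√n τ = √(τ ·
nτ)` (`dist_minimizingMovement_le`). Contractivity also handles the change of initial point, and the
slope bound handles the gap between `t` and `t_τ`. -/

namespace MetricEVI

/-! ### Comparison principles for Dini derivatives -/

/-- Comparison principle for a continuous function whose upper right Dini derivative is controlled
on the open interval. -/
theorem le_of_dini_lt {f B B' F : ℝ → ℝ} {b : ℝ} (hf : ContinuousOn f (Set.Icc 0 b))
    (hF : ∀ t ∈ Set.Ioo 0 b, ∀ r, F t < r → ∀ᶠ z in 𝓝[>] t, _root_.slope f t z < r)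
    (hB : ∀ t, HasDerivAt B (B' t) t) (h0 : f 0 < B 0)
    (bound : ∀ t ∈ Set.Ioo 0 b, f t = B t → F t < B' t) {t : ℝ} (ht : t ∈ Set.Icc 0 b) :
    f t ≤ B t := by
  rcases ht.1.eq_or_lt with rfl | h0t
  · exact h0.le
  have hBc : Continuous B := continuous_iff_continuousAt.2 fun s => (hB s).continuousAt
  -- No derivative bound is available at time `0`. The strict initial inequality persists up to some
  -- `a > 0`, and the comparison starts from there.
  have h1 : ∀ᶠ a in 𝓝[>] (0 : ℝ), f a < B a := by
    have hf0 : Tendsto f (𝓝[>] 0) (𝓝 (f 0)) := by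
      refine (hf 0 ⟨le_rfl, ht.1.trans ht.2⟩).mono_left ?_
      rw [← nhdsWithin_Ioo_eq_nhdsGT (h0t.trans_le ht.2)]
      exact nhdsWithin_mono _ Set.Ioo_subset_Icc_self
    exact hf0.eventually_lt (hBc.continuousAt.tendsto.mono_left nhdsWithin_le_nhds) h0
  obtain ⟨a, ha, ha0, hat⟩ := (h1.and (Ioo_mem_nhdsGT h0t)).exists
  refine image_le_of_liminf_slope_right_lt_deriv_boundary' (a := a) (b := b) (f' := F) (B' := B')
    (hf.mono (Set.Icc_subset_Icc_left ha0.le)) ?_ ha.le hBc.continuousOn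
    (fun x _ => (hB x).hasDerivWithinAt) ?_ ⟨hat.le, ht.2⟩
  · intro x hx r hr
    exact (hF x ⟨ha0.trans_le hx.1, hx.2⟩ r hr).frequently
  · exact fun x hx => bound x ⟨ha0.trans_le hx.1, hx.2⟩

/-- Gronwall's inequality for Dini derivatives, with a supersolution as upper bound. -/
theorem le_of_dini_le {f B B' g : ℝ → ℝ} {b K : ℝ}
    (hf : ContinuousOn f (Set.Icc 0 b))
    (hF : ∀ t ∈ Set.Ioo 0 b, ∀ r, K * f t + g t < r → ∀ᶠ z in 𝓝[>] t, _root_.slope f t z < r)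
    (hB : ∀ t, HasDerivAt B (B' t) t) (h0 : f 0 ≤ B 0)
    (bound : ∀ t ∈ Set.Ioo 0 b, K * B t + g t ≤ B' t) {t : ℝ} (ht : t ∈ Set.Icc 0 b) :
    f t ≤ B t := by
  -- The rate `K + 1` exceeds `K`, so the perturbed barrier is a strict supersolution.
  have key : ∀ ε : ℝ, 0 < ε → f t ≤ B t + ε * Real.exp ((K + 1) * t) := by
    intro ε hε
    refine le_of_dini_lt (F := fun s => K * f s + g s)
      (B := fun s => B s + ε * Real.exp ((K + 1) * s))
      (B' := fun s => B' s + ε * (Real.exp ((K + 1) * s) * (K + 1))) hf hF ?_ ?_ ?_ ht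
    · intro s
      have h := ((hasDerivAt_id s).const_mul (K + 1)).exp.const_mul ε
      simpa using (hB s).fun_add h
    · simpa using h0.trans_lt (lt_add_of_pos_right _ hε)
    · intro s hs hfs
      simp only [hfs]
      have := bound s hs
      have : 0 < ε * Real.exp ((K + 1) * s) := by positivity
      nlinarith
  have hlim : Tendsto (fun ε : ℝ => B t + ε * Real.exp ((K + 1) * t)) (𝓝[>] 0) (𝓝 (B t)) := by
    have : Continuous fun ε : ℝ => B t + ε * Real.exp ((K + 1) * t) := by fun_prop
    simpa using (this.tendsto 0).mono_left (nhdsWithin_le_nhds (s := Set.Ioi 0))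
  exact ge_of_tendsto hlim (eventually_mem_nhdsWithin.mono key)

/-! ### Energy along an EVI-flow and the integrated inequality -/

section
variable {X : Type*} [MetricSpace X] {φ : X → EReal}

theorem coe_toReal_of_mem (hφ : IsSystem φ) {x : X} (hx : x ∈ effDom φ) :
    ((φ x).toReal : EReal) = φ x :=
  EReal.coe_toReal (ne_of_lt hx) (hφ.ne_bot x)

theorem le_coe_iff_of_mem (hφ : IsSystem φ) {x : X} (hx : x ∈ effDom φ) {c : ℝ} :
    φ x ≤ c ↔ (φ x).toReal ≤ c := by
  rw [← coe_toReal_of_mem hφ hx, EReal.coe_le_coe_iff, EReal.toReal_coe]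

theorem dini_of_upperRightDeriv_lt {f : ℝ → ℝ} {t r : ℝ} (h : upperRightDeriv f t < (r : EReal)) :
    ∀ᶠ z in 𝓝[>] t, _root_.slope f t z < r := by
  have h1 := eventually_lt_of_limsup_lt h
  have h2 : Tendsto (fun z : ℝ => z - t) (𝓝[>] t) (𝓝[>] 0) := by
    refine tendsto_nhdsWithin_iff.2 ⟨?_, ?_⟩
    · have : Continuous fun z : ℝ => z - t := by fun_prop
      simpa using (this.tendsto t).mono_left nhdsWithin_le_nhds
    · filter_upwards [self_mem_nhdsWithin] with z hz using sub_pos.2 (Set.mem_Ioi.1 hz)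
  filter_upwards [h2.eventually h1] with z hz
  have h3 : (f (t + (z - t)) - f t) / (z - t) < r := by exact_mod_cast hz
  rw [slope_def_field]
  simpa using h3

variable {μ : ℝ} {D : Set X} {S : ℝ → X → X}

theorem IsEVIFlow.dini (hφ : IsSystem φ) (hS : IsEVIFlow φ (-μ) D S) {x v : X} (hx : x ∈ D)
    (hv : v ∈ effDom φ) {t r : ℝ} (ht : 0 < t)
    (hr : μ * dist (S t x) v ^ 2 + 2 * ((φ v).toReal - (φ (S t x)).toReal) < r) :
    ∀ᶠ z in 𝓝[>] t, _root_.slope (fun s => dist (S s x) v ^ 2) t z < r := by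
  apply dini_of_upperRightDeriv_lt
  have h := (hS.solution x hx).evi t ht v hv
  rw [← coe_toReal_of_mem hφ hv, ← coe_toReal_of_mem hφ ((hS.solution x hx).mem t ht)] at h
  revert h
  generalize upperRightDeriv (fun s => dist (S s x) v ^ 2) t = L
  induction L with
  | bot => intro _; exact EReal.bot_lt_coe r
  | top =>
    intro h
    exfalso
    rw [EReal.coe_mul_top_of_pos (by norm_num), EReal.top_add_coe, ← EReal.coe_sub] at h
    exact absurd h (not_le.2 (EReal.coe_lt_top _))
  | coe l =>
    intro h
    have h' : 1 / 2 * l + -μ / 2 * dist (S t x) v ^ 2 ≤ (φ v).toReal - (φ (S t x)).toReal := by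
      exact_mod_cast h
    refine EReal.coe_lt_coe_iff.2 ?_
    linarith

theorem IsEVIFlow.mem_effDom (hS : IsEVIFlow φ (-μ) D S) {x : X} (hx : x ∈ D) {t : ℝ}
    (ht : 0 < t) : S t x ∈ effDom φ :=
  (hS.solution x hx).mem t ht

theorem IsEVIFlow.continuousOn_Ici (hS : IsEVIFlow φ (-μ) D S) {x : X} (hx : x ∈ D) :
    ContinuousOn (fun t => S t x) (Set.Ici 0) := by
  intro t ht
  rcases (Set.mem_Ici.1 ht).eq_or_lt with rfl | h
  · rw [ContinuousWithinAt, hS.zero x hx]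
    rw [← Set.Ioi_insert, nhdsWithin_insert, tendsto_sup]
    refine ⟨?_, hS.tendsto x hx⟩
    rw [tendsto_pure_left]
    intro s hs
    have : S 0 x = x := hS.zero x hx
    simpa [this] using mem_of_mem_nhds hs
  · exact ((hS.solution x hx).cont.continuousAt (Ioi_mem_nhds h)).continuousWithinAt

theorem IsEVIFlow.continuousOn_dist_sq (hS : IsEVIFlow φ (-μ) D S) {x : X} (hx : x ∈ D) (v : X)
    (b : ℝ) : ContinuousOn (fun t => dist (S t x) v ^ 2) (Set.Icc 0 b) :=
  (continuous_id.dist continuous_const).pow 2 |>.comp_continuousOn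
    ((hS.continuousOn_Ici hx).mono Set.Icc_subset_Ici_self)

/-- Arbitrarily soon after the initial time, the energy does not exceed its initial value. -/
theorem IsEVIFlow.exists_energy_le (hφ : IsSystem φ) (hS : IsEVIFlow φ (-μ) D S)
    {x : X} (hx : x ∈ D) (hxd : x ∈ effDom φ) {b : ℝ} (hb : 0 < b) :
    ∃ r ∈ Set.Ioc 0 b, φ (S r x) ≤ φ x := by
  by_contra! hcon
  -- If the energy exceeded `φ x` on all of `(0, b]`, the EVI tested at `x` itself would freeze the
  -- curve at `x`, where the energy equals `φ x`.
  have hle : ∀ t ∈ Set.Icc 0 b, dist (S t x) x ^ 2 ≤ 0 := by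
    intro t ht
    refine le_of_dini_le (f := fun t => dist (S t x) x ^ 2) (B := fun _ => 0) (B' := fun _ => 0)
      (g := fun _ => 0) (K := μ) (hS.continuousOn_dist_sq hx x b) ?_
      (fun s => hasDerivAt_const s 0) ?_ ?_ ht
    · intro s hs r hr
      refine hS.dini hφ hx hxd hs.1 (lt_of_le_of_lt ?_ hr)
      have h1 := (hcon s ⟨hs.1, hs.2.le⟩).le
      rw [← coe_toReal_of_mem hφ (hS.mem_effDom hx hs.1),
        le_coe_iff_of_mem hφ hxd] at h1
      linarith
    · simp [hS.zero x hx]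
    · simp
  have h1 := hle b ⟨hb.le, le_rfl⟩
  have h2 : S b x = x := by
    have : dist (S b x) x = 0 := by nlinarith [sq_nonneg (dist (S b x) x)]
    exact dist_eq_zero.1 this
  have h3 := hcon b ⟨hb, le_rfl⟩
  rw [h2] at h3
  exact lt_irrefl _ h3

/-- Real induction on time: the admissible times form a closed set by lower semicontinuity, and
`exists_energy_le` restarted through the semigroup property always extends it to the right. -/
theorem IsEVIFlow.energy_le_initial (hφ : IsSystem φ) (hS : IsEVIFlow φ (-μ) D S)
    {x : X} (hx : x ∈ D) (hxd : x ∈ effDom φ) {t : ℝ} (ht : 0 ≤ t) :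
    φ (S t x) ≤ φ x := by
  have hsub : Set.Icc 0 t ⊆ {r | φ (S r x) ≤ φ x} := by
    refine IsClosed.Icc_subset_of_forall_exists_gt ?_ ?_ ?_
    · have hc : ContinuousOn (fun r => S r x) (Set.Icc 0 t) :=
        (hS.continuousOn_Ici hx).mono Set.Icc_subset_Ici_self
      have := hc.preimage_isClosed_of_isClosed isClosed_Icc (hφ.lsc.isClosed_preimage (φ x))
      rwa [Set.inter_comm] at this
    · simp [hS.zero x hx]
    · rintro s ⟨hs, hst⟩ y hy
      have hsD : S s x ∈ D := hS.mapsTo s hst.1 hx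
      obtain ⟨r, hr, hr'⟩ := hS.exists_energy_le hφ hsD
        (show φ (S s x) < ⊤ from lt_of_le_of_lt hs hxd)
        (sub_pos.2 (Set.mem_Ioi.1 hy))
      refine ⟨s + r, ?_, ⟨by linarith [hr.1], by linarith [hr.2]⟩⟩
      rw [Set.mem_ofPred_eq, hS.semigroup x hx s r hst.1 hr.1.le]
      exact hr'.trans hs
  exact hsub ⟨ht, le_rfl⟩

theorem IsEVIFlow.mem_effDom_of_mem (hφ : IsSystem φ) (hS : IsEVIFlow φ (-μ) D S)
    {x : X} (hx : x ∈ D) (hxd : x ∈ effDom φ) {t : ℝ} (ht : 0 ≤ t) : S t x ∈ effDom φ :=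
  lt_of_le_of_lt (hS.energy_le_initial hφ hx hxd ht) hxd

theorem IsEVIFlow.toReal_energy_le_initial (hφ : IsSystem φ)
    (hS : IsEVIFlow φ (-μ) D S) {x : X} (hx : x ∈ D) (hxd : x ∈ effDom φ) {t : ℝ} (ht : 0 ≤ t) :
    (φ (S t x)).toReal ≤ (φ x).toReal := by
  rw [← le_coe_iff_of_mem hφ (hS.mem_effDom_of_mem hφ hx hxd ht), coe_toReal_of_mem hφ hxd]
  exact hS.energy_le_initial hφ hx hxd ht

theorem IsEVIFlow.energy_antitone (hφ : IsSystem φ)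
    (hS : IsEVIFlow φ (-μ) D S) {x : X} (hx : x ∈ D) {s t : ℝ} (hs : 0 < s) (hst : s ≤ t) :
    (φ (S t x)).toReal ≤ (φ (S s x)).toReal := by
  have := hS.toReal_energy_le_initial hφ (hS.mapsTo s hs.le hx) (hS.mem_effDom hx hs)
    (sub_nonneg.2 hst)
  rwa [← hS.semigroup x hx s (t - s) hs.le (sub_nonneg.2 hst), add_sub_cancel] at this

/-- The energy is right-continuous at the initial time. -/
theorem IsEVIFlow.tendsto_energy (hφ : IsSystem φ)
    (hS : IsEVIFlow φ (-μ) D S) {x : X} (hx : x ∈ D) (hxd : x ∈ effDom φ) :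
    Tendsto (fun h => (φ (S h x)).toReal) (𝓝[>] 0) (𝓝 (φ x).toReal) := by
  refine tendsto_order.2 ⟨fun a ha => ?_, fun a ha => ?_⟩
  · have h1 : (a : EReal) < φ x := by
      rw [← coe_toReal_of_mem hφ hxd]; exact_mod_cast ha
    filter_upwards [(hS.tendsto x hx).eventually (hφ.lsc x a h1), self_mem_nhdsWithin] with h hh h0
    rw [← coe_toReal_of_mem hφ (hS.mem_effDom hx h0)] at hh
    exact_mod_cast hh
  · filter_upwards [self_mem_nhdsWithin] with h h0
    exact (hS.toReal_energy_le_initial hφ hx hxd (le_of_lt h0)).trans_lt ha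

/-- The integrated evolution variational inequality. The function `gronwallBound 0 μ 1` is the
solution of `E' = μ * E + 1`, `E 0 = 0`. -/
theorem IsEVIFlow.integrated (hφ : IsSystem φ) (hS : IsEVIFlow φ (-μ) D S)
    {x v : X} (hx : x ∈ D) (hv : v ∈ effDom φ) {h : ℝ} (hh : 0 < h) :
    dist (S h x) v ^ 2 ≤ Real.exp (μ * h) * dist x v ^ 2
      + 2 * gronwallBound 0 μ 1 h * ((φ v).toReal - (φ (S h x)).toReal) := by
  set C := (φ v).toReal - (φ (S h x)).toReal with hC
  refine le_of_dini_le (f := fun s => dist (S s x) v ^ 2) (K := μ) (g := fun _ => 2 * C)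
    (B := fun s => Real.exp (μ * s) * dist x v ^ 2 + 2 * gronwallBound 0 μ 1 s * C)
    (B' := fun s => Real.exp (μ * s) * μ * dist x v ^ 2
      + 2 * (μ * gronwallBound 0 μ 1 s + 1) * C)
    (hS.continuousOn_dist_sq hx v h) ?_ ?_ ?_ ?_ ⟨hh.le, le_rfl⟩
  · intro s hs r hr
    refine hS.dini hφ hx hv hs.1 (lt_of_le_of_lt ?_ hr)
    -- Monotonicity replaces the energy at time `s` by its smaller value at the final time `h`,
    -- which makes the forcing constant.
    have := hS.energy_antitone hφ hx hs.1 hs.2.le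
    linarith
  · intro s
    have h1 := ((hasDerivAt_id s).const_mul μ).exp.mul_const (dist x v ^ 2)
    have h2 := ((hasDerivAt_gronwallBound 0 μ 1 s).const_mul 2).mul_const C
    simpa using h1.fun_add h2
  · simp [hS.zero x hx, gronwallBound_x0]
  · intro s _
    linarith

/-- This identity, with no division by `μ`, lets later arguments treat `μ = 0` and `μ > 0` together.
-/
theorem mul_gronwallBound_zero_one (μ h : ℝ) :
    μ * gronwallBound 0 μ 1 h = Real.exp (μ * h) - 1 := by
  rcases eq_or_ne μ 0 with rfl | hμ
  · simp
  · rw [gronwallBound_of_K_ne_0 hμ]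
    field_simp
    ring

theorem le_gronwallBound_zero_one {μ h : ℝ} (hμ : 0 ≤ μ) : h ≤ gronwallBound 0 μ 1 h := by
  rcases hμ.eq_or_lt with rfl | hμ'
  · simp [gronwallBound_K0]
  · have h1 := mul_gronwallBound_zero_one μ h
    have h2 := Real.add_one_le_exp (μ * h)
    exact le_of_mul_le_mul_left (by linarith) hμ'

theorem tendsto_gronwallBound_div (μ : ℝ) :
    Tendsto (fun h => gronwallBound 0 μ 1 h / h) (𝓝[>] 0) (𝓝 1) := by
  have h := (hasDerivAt_gronwallBound 0 μ 1 0).tendsto_slope_zero_right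
  simpa [gronwallBound_x0, div_eq_inv_mul] using h

end

/-! ### Contractivity and the slope along the flow -/

section
variable {X : Type*} [MetricSpace X] {φ : X → EReal}
variable {μ : ℝ} {D : Set X} {S : ℝ → X → X}

/-- Apply the integrated inequality to `x` with test point `S h y`, then to `y` with test point `x`.
The mixed energies nearly cancel, and right-continuity of the energy makes the remainder `o(h)`; no
differentiation in two time variables is needed. -/
theorem IsEVIFlow.dist_sq_step (hφ : IsSystem φ) (hS : IsEVIFlow φ (-μ) D S) {x y : X}
    (hx : x ∈ D) (hxd : x ∈ effDom φ) (hy : y ∈ D) {h : ℝ} (hh : 0 < h) :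
    dist (S h x) (S h y) ^ 2 ≤ Real.exp (2 * μ * h) * dist x y ^ 2
      + 2 * gronwallBound 0 μ 1 h * (((φ x).toReal - (φ (S h x)).toReal)
        + (Real.exp (μ * h) - 1) * ((φ x).toReal - (φ (S h y)).toReal)) := by
  have h1 := hS.integrated hφ hx (hS.mem_effDom hy hh) hh
  have h2 := hS.integrated hφ hy hxd hh
  rw [dist_comm x (S h y)] at h1
  rw [dist_comm y x] at h2
  have h3 := mul_le_mul_of_nonneg_left h2 (Real.exp_pos (μ * h)).le
  have h4 : Real.exp (2 * μ * h) = Real.exp (μ * h) * Real.exp (μ * h) := by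
    rw [← Real.exp_add]; congr 1; ring
  rw [h4]
  linarith

theorem tendsto_exp_sub_one_div (K : ℝ) :
    Tendsto (fun h => (Real.exp (K * h) - 1) / h) (𝓝[>] 0) (𝓝 K) := by
  have h := ((hasDerivAt_id (0 : ℝ)).const_mul K).exp.tendsto_slope_zero_right
  simpa [div_eq_inv_mul] using h

/-- `EVI`-gradient flows are contractive up to an exponential factor. -/
theorem IsEVIFlow.dist_le (hφ : IsSystem φ) (hS : IsEVIFlow φ (-μ) D S) {x y : X}
    (hx : x ∈ D) (hy : y ∈ D) {t : ℝ} (ht : 0 ≤ t) :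
    dist (S t x) (S t y) ≤ Real.exp (μ * t) * dist x y := by
  have key : dist (S t x) (S t y) ^ 2 ≤ Real.exp (2 * μ * t) * dist x y ^ 2 := by
    refine le_of_dini_le (f := fun s => dist (S s x) (S s y) ^ 2) (K := 2 * μ) (g := fun _ => 0)
      (b := t) (B := fun s => Real.exp (2 * μ * s) * dist x y ^ 2)
      (B' := fun s => Real.exp (2 * μ * s) * (2 * μ) * dist x y ^ 2) ?_ ?_ ?_ ?_ ?_ ⟨ht, le_rfl⟩
    · have hpair : ContinuousOn (fun s => (S s x, S s y)) (Set.Icc 0 t) :=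
        ((hS.continuousOn_Ici hx).prodMk (hS.continuousOn_Ici hy)).mono Set.Icc_subset_Ici_self
      exact (continuous_dist.pow 2).comp_continuousOn hpair
    · intro s hs r hr
      have hxs := hS.mapsTo s hs.1.le hx
      have hys := hS.mapsTo s hs.1.le hy
      have hxd := hS.mem_effDom hx hs.1
      have hyd := hS.mem_effDom hy hs.1
      set p := S s x with hp
      set q := S s y with hq
      have hlim : Tendsto (fun h => (Real.exp (2 * μ * h) - 1) / h * dist p q ^ 2
          + 2 * (gronwallBound 0 μ 1 h / h) * (((φ p).toReal - (φ (S h p)).toReal)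
            + (Real.exp (μ * h) - 1) * ((φ p).toReal - (φ (S h q)).toReal))) (𝓝[>] 0)
          (𝓝 (2 * μ * dist p q ^ 2 + 2 * 1 * (((φ p).toReal - (φ p).toReal)
            + 0 * ((φ p).toReal - (φ q).toReal)))) := by
        have hexp : Tendsto (fun h => Real.exp (μ * h) - 1) (𝓝[>] 0) (𝓝 0) := by
          have : Continuous fun h : ℝ => Real.exp (μ * h) - 1 := by fun_prop
          simpa using (this.tendsto 0).mono_left nhdsWithin_le_nhds
        exact ((tendsto_exp_sub_one_div _).mul_const _).add
          (((tendsto_gronwallBound_div μ).const_mul 2).mul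
            ((tendsto_const_nhds.sub (hS.tendsto_energy hφ hxs hxd)).add
              (hexp.mul (tendsto_const_nhds.sub (hS.tendsto_energy hφ hys hyd)))))
      have hr' : 2 * μ * dist p q ^ 2 + 2 * 1 * (((φ p).toReal - (φ p).toReal)
            + 0 * ((φ p).toReal - (φ q).toReal)) < r := by
        simpa [hp, hq] using hr
      have hsub : Tendsto (fun z : ℝ => z - s) (𝓝[>] s) (𝓝[>] 0) := by
        refine tendsto_nhdsWithin_iff.2 ⟨?_, ?_⟩
        · have : Continuous fun z : ℝ => z - s := by fun_prop
          simpa using (this.tendsto s).mono_left nhdsWithin_le_nhds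
        · filter_upwards [self_mem_nhdsWithin] with z hz using sub_pos.2 (Set.mem_Ioi.1 hz)
      filter_upwards [hsub.eventually (hlim.eventually_lt_const hr'), self_mem_nhdsWithin]
        with z hz hsz
      have hh : 0 < z - s := sub_pos.2 (Set.mem_Ioi.1 hsz)
      refine lt_of_le_of_lt ?_ hz
      have hz1 : S z x = S (z - s) p := by
        rw [hp, ← hS.semigroup x hx s (z - s) hs.1.le hh.le, add_sub_cancel]
      have hz2 : S z y = S (z - s) q := by
        rw [hq, ← hS.semigroup y hy s (z - s) hs.1.le hh.le, add_sub_cancel]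
      rw [slope_def_field, hz1, hz2, div_le_iff₀ hh]
      have := hS.dist_sq_step hφ hxs hxd hys hh
      refine (sub_le_sub_right this _).trans (le_of_eq ?_)
      field_simp
      ring
    · intro s
      have h1 := ((hasDerivAt_id s).const_mul (2 * μ)).exp.mul_const (dist x y ^ 2)
      simpa using h1
    · simp [hS.zero x hx, hS.zero y hy]
    · intro s _
      linarith
  have h4 : Real.exp (2 * μ * t) * dist x y ^ 2 = (Real.exp (μ * t) * dist x y) ^ 2 := by
    rw [mul_pow, ← Real.exp_nat_mul]; congr 2; push_cast; ring
  rw [h4] at key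
  exact (abs_le_of_sq_le_sq' key (by positivity)).2

/-- A bound on the energy drop along the flow bounds the displacement. -/
theorem IsEVIFlow.dist_initial_le_of_energy (hφ : IsSystem φ) (hμ : 0 ≤ μ)
    (hS : IsEVIFlow φ (-μ) D S) {x : X} (hx : x ∈ D) (hxd : x ∈ effDom φ) {C b : ℝ} (hC : 0 ≤ C)
    (hE : ∀ s ∈ Set.Ioo 0 b, (φ x).toReal - (φ (S s x)).toReal ≤
      C * dist (S s x) x + μ / 2 * dist (S s x) x ^ 2) {s : ℝ} (hs : s ∈ Set.Icc 0 b) :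
    dist (S s x) x ≤ C * s * Real.exp (μ * s) := by
  -- Formally `ρ = d(S_s x, x)` satisfies `ρ' ≤ C + μρ`. The two `ε` terms keep the barrier positive
  -- at time `0` and make it strict; squares are compared because the EVI controls `ρ²`.
  have key : ∀ ε : ℝ, 0 < ε → dist (S s x) x ≤ (ε + (C + ε) * s) * Real.exp (μ * s) := by
    intro ε hε
    have hpos : ∀ r : ℝ, 0 ≤ r → 0 < (ε + (C + ε) * r) * Real.exp (μ * r) := by
      intro r hr
      positivity
    have hd : ∀ r, HasDerivAt (fun r => ((ε + (C + ε) * r) * Real.exp (μ * r)) ^ 2)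
        (2 * ((ε + (C + ε) * r) * Real.exp (μ * r)) *
          ((C + ε) * Real.exp (μ * r) + (ε + (C + ε) * r) * (Real.exp (μ * r) * μ))) r := by
      intro r
      have h1 := ((hasDerivAt_id r).const_mul μ).exp
      have h2 := ((hasDerivAt_id r).const_mul (C + ε)).const_add ε
      simpa using (h2.fun_mul h1).fun_pow 2
    have h := le_of_dini_lt (f := fun r => dist (S r x) x ^ 2)
      (F := fun r => μ * dist (S r x) x ^ 2 + 2 * ((φ x).toReal - (φ (S r x)).toReal))
      (hS.continuousOn_dist_sq hx x b) (fun r hr c hc => hS.dini hφ hx hxd hr.1 hc)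
      hd ?_ ?_ hs
    · exact (abs_le_of_sq_le_sq' h (hpos s hs.1).le).2
    · simpa [hS.zero x hx] using pow_pos hε 2
    · intro r hr hfr
      have hp := hpos r hr.1.le
      have h1 : dist (S r x) x = (ε + (C + ε) * r) * Real.exp (μ * r) :=
        (sq_eq_sq₀ dist_nonneg hp.le).1 hfr
      have h2 := hE r hr
      have h3 : 1 ≤ Real.exp (μ * r) := Real.one_le_exp (mul_nonneg hμ hr.1.le)
      rw [h1] at h2 ⊢
      set w := (ε + (C + ε) * r) * Real.exp (μ * r) with hw
      have h4 : (ε + (C + ε) * r) * (Real.exp (μ * r) * μ) = μ * w := by rw [hw]; ring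
      rw [h4]
      have h5 : C < (C + ε) * Real.exp (μ * r) := by nlinarith
      have h6 := mul_lt_mul_of_pos_left h5 hp
      nlinarith
  have hlim : Tendsto (fun ε : ℝ => (ε + (C + ε) * s) * Real.exp (μ * s)) (𝓝[>] 0)
      (𝓝 (C * s * Real.exp (μ * s))) := by
    have : Continuous fun ε : ℝ => (ε + (C + ε) * s) * Real.exp (μ * s) := by fun_prop
    simpa using (this.tendsto 0).mono_left (nhdsWithin_le_nhds (s := Set.Ioi 0))
  exact ge_of_tendsto hlim (eventually_mem_nhdsWithin.mono key)

theorem eventually_energy_sub_le_of_slope_lt (hφ : IsSystem φ) {x : X} (hxd : x ∈ effDom φ)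
    {C : ℝ} (hC : 0 ≤ C) (h : slope φ x < ENNReal.ofReal C) :
    ∀ᶠ y in 𝓝 x, y ∈ effDom φ → (φ x).toReal - (φ y).toReal ≤ C * dist y x := by
  rw [slope, if_pos (show φ x < ⊤ from hxd)] at h
  have h1 := eventually_nhdsWithin_iff.1 (eventually_lt_of_limsup_lt h)
  filter_upwards [h1] with y hy hyd
  rcases eq_or_ne y x with rfl | hne
  · simp
  have h2 := (hy hne).le
  rw [ENNReal.div_le_iff (edist_pos.2 hne.symm).ne' (edist_ne_top _ _), edist_dist,
    ← ENNReal.ofReal_mul hC, ← coe_toReal_of_mem hφ hxd, ← coe_toReal_of_mem hφ hyd,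
    ← EReal.coe_sub, EReal.toENNReal_of_ne_top (EReal.coe_ne_top _), EReal.toReal_coe,
    ENNReal.ofReal_le_ofReal_iff (by positivity)] at h2
  rwa [dist_comm y x]

/-- Along an `EVI`-flow the local slope controls the energy globally. -/
theorem IsEVIFlow.energy_sub_le (hφ : IsSystem φ) (hμ : 0 ≤ μ)
    (hS : IsEVIFlow φ (-μ) D S) {x y : X} (hx : x ∈ D) (hxd : x ∈ effDom φ) (hy : y ∈ effDom φ)
    {G : ℝ} (hG : 0 ≤ G) (hslope : slope φ x ≤ ENNReal.ofReal G) :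
    (φ x).toReal - (φ y).toReal ≤ G * dist y x + μ / 2 * dist y x ^ 2 := by
  have key : ∀ C : ℝ, G < C →
      (φ x).toReal - (φ y).toReal ≤ C * dist y x + μ / 2 * dist y x ^ 2 := by
    intro C hGC
    have hC : 0 ≤ C := hG.trans hGC.le
    have h1 := (hS.tendsto x hx).eventually (eventually_energy_sub_le_of_slope_lt hφ hxd hC
      (hslope.trans_lt ((ENNReal.ofReal_lt_ofReal_iff (hG.trans_lt hGC)).2 hGC)))
    obtain ⟨b, hb, hbs⟩ := mem_nhdsGT_iff_exists_Ioo_subset.1 h1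
    -- The slope is needed only near `x`, to get `d(S_h x, x) ≤ C h e^{μh}`. The integrated EVI with
    -- test point `y`, divided by `2E`, turns this into a global bound, and `μE = e^{μh} - 1`
    -- produces the quadratic term.
    have hbound : ∀ h ∈ Set.Ioo 0 b, (φ (S h x)).toReal - (φ y).toReal ≤
        C * Real.exp (μ * h) * dist y x + μ / 2 * dist y x ^ 2 := by
      intro h hh
      have h2 : dist (S h x) x ≤ C * h * Real.exp (μ * h) := by
        refine hS.dist_initial_le_of_energy hφ hμ hx hxd (b := b) hC (fun s hs => ?_)
          ⟨hh.1.le, hh.2.le⟩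
        have := hbs hs (hS.mem_effDom hx hs.1)
        nlinarith [sq_nonneg (dist (S s x) x)]
      have h3 := hS.integrated hφ hx hy hh.1
      have h4 := mul_gronwallBound_zero_one μ h
      have h5 := le_gronwallBound_zero_one (h := h) hμ
      have hE : 0 < gronwallBound 0 μ 1 h := hh.1.trans_le h5
      set E := gronwallBound 0 μ 1 h
      have h6 : dist y x - dist (S h x) x ≤ dist (S h x) y := by
        have := dist_triangle y (S h x) x
        rw [dist_comm y (S h x)] at this
        linarith
      have h7 : dist y x ^ 2 - 2 * dist y x * dist (S h x) x ≤ dist (S h x) y ^ 2 := by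
        rcases le_total (dist (S h x) x) (dist y x) with hc | hc
        · nlinarith [sq_nonneg (dist (S h x) x)]
        · nlinarith [sq_nonneg (dist (S h x) y), dist_nonneg (x := y) (y := x)]
      rw [dist_comm x y] at h3
      have h8 : dist y x * dist (S h x) x ≤ dist y x * (C * E * Real.exp (μ * h)) := by
        refine mul_le_mul_of_nonneg_left (h2.trans ?_) dist_nonneg
        gcongr
      refine le_of_mul_le_mul_left (a := 2 * E) ?_ (by positivity)
      have h9 : Real.exp (μ * h) * dist y x ^ 2 = dist y x ^ 2 + μ * E * dist y x ^ 2 := by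
        rw [h4]; ring
      linarith
    have hlim : Tendsto (fun h => C * Real.exp (μ * h) * dist y x + μ / 2 * dist y x ^ 2) (𝓝[>] 0)
        (𝓝 (C * dist y x + μ / 2 * dist y x ^ 2)) := by
      have : Continuous fun h : ℝ =>
          C * Real.exp (μ * h) * dist y x + μ / 2 * dist y x ^ 2 := by fun_prop
      simpa using (this.tendsto 0).mono_left (nhdsWithin_le_nhds (s := Set.Ioi 0))
    refine le_of_tendsto_of_tendsto ((hS.tendsto_energy hφ hx hxd).sub_const _) hlim ?_
    filter_upwards [Ioo_mem_nhdsGT hb] with h hh using hbound h hh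
  have hlim : Tendsto (fun C : ℝ => C * dist y x + μ / 2 * dist y x ^ 2) (𝓝[>] G)
      (𝓝 (G * dist y x + μ / 2 * dist y x ^ 2)) := by
    have : Continuous fun C : ℝ => C * dist y x + μ / 2 * dist y x ^ 2 := by fun_prop
    exact (this.tendsto G).mono_left nhdsWithin_le_nhds
  exact ge_of_tendsto hlim (eventually_mem_nhdsWithin.mono key)

theorem IsEVIFlow.dist_initial_le (hφ : IsSystem φ) (hμ : 0 ≤ μ)
    (hS : IsEVIFlow φ (-μ) D S) {x : X} (hx : x ∈ D) (hxd : x ∈ effDom φ)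
    {G : ℝ} (hG : 0 ≤ G) (hslope : slope φ x ≤ ENNReal.ofReal G) {s : ℝ} (hs : 0 ≤ s) :
    dist (S s x) x ≤ G * s * Real.exp (μ * s) :=
  hS.dist_initial_le_of_energy hφ hμ hx hxd hG (b := s)
    (fun _ hr => hS.energy_sub_le hφ hμ hx hxd (hS.mem_effDom hx hr.1) hG hslope) ⟨hs, le_rfl⟩

/-! ### Approximate convexity of the energy -/

/-- The energy is almost convex along suitable almost midpoints. -/
theorem IsEVIFlow.exists_almost_midpoint (hφ : IsSystem φ) (hμ : 0 ≤ μ)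
    (hS : IsEVIFlow φ (-μ) D S) (hD : effDom φ ⊆ D) (hlen : IsApproxLength (effDom φ))
    {x y : X} (hx : x ∈ effDom φ) (hy : y ∈ effDom φ) {ε : ℝ} (hε : 0 < ε) :
    ∃ m ∈ effDom φ, dist x m ≤ dist x y / 2 + ε ∧ dist m y ≤ dist x y / 2 + ε ∧
      (φ m).toReal ≤ ((φ x).toReal + (φ y).toReal) / 2 + μ / 8 * dist x y ^ 2 + ε := by
  set d := dist x y with hd
  obtain ⟨h, hh, hexp, hhx, hhy⟩ : ∃ h : ℝ, 0 < h ∧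
      Real.exp (μ * h) * (d / 2 + ε / 4) < d / 2 + ε / 2 ∧ dist (S h x) x < ε / 2 ∧
      dist (S h y) y < ε / 2 := by
    have h1 : ∀ᶠ h in 𝓝[>] (0 : ℝ), Real.exp (μ * h) * (d / 2 + ε / 4) < d / 2 + ε / 2 := by
      have hc : Continuous fun h : ℝ => Real.exp (μ * h) * (d / 2 + ε / 4) := by fun_prop
      refine ((hc.tendsto 0).mono_left nhdsWithin_le_nhds).eventually_lt_const ?_
      simp
      linarith
    have h2 := (hS.tendsto x (hD hx)).eventually (Metric.ball_mem_nhds x (half_pos hε))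
    have h3 := (hS.tendsto y (hD hy)).eventually (Metric.ball_mem_nhds y (half_pos hε))
    obtain ⟨h, h4, h5, h6, h7⟩ := (h1.and (h2.and (h3.and self_mem_nhdsWithin))).exists
    exact ⟨h, h7, h4, h5, h6⟩
  have h4 := mul_gronwallBound_zero_one μ h
  have hE : 0 < gronwallBound 0 μ 1 h := hh.trans_le (le_gronwallBound_zero_one hμ)
  set E := gronwallBound 0 μ 1 h
  -- The midpoint accuracy `δ` is chosen after the flow time `h`: its energy error `e^{μh} δ² d² /
  -- (32 E)` blows up as `E → 0`.
  obtain ⟨δ, hδ0, hδ1, hδd, hδE⟩ : ∃ δ : ℝ, 0 < δ ∧ δ < 1 ∧ δ * d < ε / 4 ∧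
      Real.exp (μ * h) * δ ^ 2 * d ^ 2 < 32 * E * ε := by
    have h1 : ∀ᶠ δ in 𝓝[>] (0 : ℝ), δ * d < ε / 4 := by
      have hc : Continuous fun δ : ℝ => δ * d := by fun_prop
      refine ((hc.tendsto 0).mono_left nhdsWithin_le_nhds).eventually_lt_const ?_
      simp
      linarith
    have h2 : ∀ᶠ δ in 𝓝[>] (0 : ℝ), Real.exp (μ * h) * δ ^ 2 * d ^ 2 < 32 * E * ε := by
      have hc : Continuous fun δ : ℝ => Real.exp (μ * h) * δ ^ 2 * d ^ 2 := by fun_prop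
      refine ((hc.tendsto 0).mono_left nhdsWithin_le_nhds).eventually_lt_const ?_
      simp
      positivity
    obtain ⟨δ, h5, h6, h7⟩ := (h1.and (h2.and (Ioo_mem_nhdsGT one_pos))).exists
    exact ⟨δ, h7.1, h7.2, h5, h6⟩
  obtain ⟨v, hv, hmid⟩ := hlen x hx y hy δ hδ0 hδ1
  have hmid' : dist x v ^ 2 + dist v y ^ 2 ≤ d ^ 2 / 2 * (1 + δ ^ 2 / 4) := by
    unfold IsIntermediatePoint at hmid
    norm_num at hmid
    linarith
  have htri := dist_triangle x v y
  have hd0 : 0 ≤ d := dist_nonneg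
  have hdev : (dist x v - d / 2) ^ 2 + (dist v y - d / 2) ^ 2 ≤ (δ * d) ^ 2 := by
    nlinarith [mul_nonneg hd0 (sub_nonneg.2 htri), sq_nonneg (δ * d)]
  have hδd0 : 0 ≤ δ * d := by positivity
  have ha := (abs_le_of_sq_le_sq' (a := dist x v - d / 2) (b := δ * d)
    (by nlinarith [sq_nonneg (dist v y - d / 2)]) hδd0).2
  have hb := (abs_le_of_sq_le_sq' (a := dist v y - d / 2) (b := δ * d)
    (by nlinarith [sq_nonneg (dist x v - d / 2)]) hδd0).2
  have hep := Real.exp_pos (μ * h)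
  refine ⟨S h v, hS.mem_effDom (hD hv) hh, ?_, ?_, ?_⟩
  · have h1 := hS.dist_le hφ (hD hx) (hD hv) hh.le
    have h2 := dist_triangle x (S h x) (S h v)
    rw [dist_comm x (S h x)] at h2
    have h3 := mul_le_mul_of_nonneg_left
      (show dist x v ≤ d / 2 + ε / 4 by linarith) hep.le
    linarith
  · have h1 := hS.dist_le hφ (hD hv) (hD hy) hh.le
    have h2 := dist_triangle (S h v) (S h y) y
    have h3 := mul_le_mul_of_nonneg_left
      (show dist v y ≤ d / 2 + ε / 4 by linarith) hep.le
    linarith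
  -- Sum the integrated EVI for `v` over the test points `x` and `y`; the squared distances from `S
  -- h v` to them add up to at least `d²/2`.
  · have h1 := hS.integrated hφ (hD hv) hx hh
    have h2 := hS.integrated hφ (hD hv) hy hh
    have h3 := dist_triangle_left x y (S h v)
    have h5 : d ^ 2 / 2 ≤ dist (S h v) x ^ 2 + dist (S h v) y ^ 2 := by
      nlinarith [sq_nonneg (dist (S h v) x - dist (S h v) y)]
    rw [dist_comm v x] at h1
    have h6 := mul_le_mul_of_nonneg_left hmid' hep.le
    refine le_of_mul_le_mul_left (a := 4 * E) ?_ (by positivity)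
    have h9 : Real.exp (μ * h) * d ^ 2 = d ^ 2 + μ * E * d ^ 2 := by
      rw [h4]; ring
    linarith

end

/-! ### One step of the scheme -/

section
variable {X : Type*} [MetricSpace X] {φ : X → EReal}
variable {μ τ η : ℝ} {D : Set X} {S : ℝ → X → X}

theorem minimality_toReal (hφ : IsSystem φ) {x u y : X} (hu : u ∈ resolvent φ τ η x)
    (hy : y ∈ effDom φ) :
    1 / (2 * τ) * dist x u ^ 2 + (φ u).toReal ≤
      1 / (2 * τ) * dist x y ^ 2 + (φ y).toReal + η / 2 * dist x u * dist y u := by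
  have h := hu.2.1 y
  rw [← coe_toReal_of_mem hφ hu.1, ← coe_toReal_of_mem hφ hy] at h
  exact_mod_cast h

/-- Repeatedly taking almost midpoints with `u` gives points approaching `u`, which replace a
geodesic ending there. The convexity defects recombine exactly into `θ(1 - θ)`. -/
theorem IsEVIFlow.exists_almost_dyadic_point (hφ : IsSystem φ) (hμ : 0 ≤ μ)
    (hS : IsEVIFlow φ (-μ) D S) (hD : effDom φ ⊆ D) (hlen : IsApproxLength (effDom φ))
    {x u : X} (hx : x ∈ effDom φ) (hu : u ∈ effDom φ) (k : ℕ) {ε : ℝ} (hε : 0 < ε) :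
    ∃ m ∈ effDom φ, dist x m ≤ (1 - (1 / 2) ^ k) * dist x u + ε ∧
      dist m u ≤ (1 / 2) ^ k * dist x u + ε ∧
      (φ m).toReal ≤ (1 - (1 / 2) ^ k) * (φ u).toReal + (1 / 2) ^ k * (φ x).toReal
        + μ / 2 * ((1 / 2) ^ k * (1 - (1 / 2) ^ k)) * dist x u ^ 2 + ε := by
  induction k generalizing ε with
  | zero => exact ⟨x, hx, by simpa using hε.le, by simpa using hε.le, by simpa using hε.le⟩
  | succ k ih =>
    set θ : ℝ := (1 / 2) ^ k
    set δ := dist x u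
    obtain ⟨r, hr0, hr1, hr2⟩ : ∃ r : ℝ, 0 < r ∧ 3 * r < ε ∧
        3 / 2 * r + μ / 8 * (θ * δ + r) ^ 2 < μ / 8 * (θ * δ) ^ 2 + ε := by
      have h1 : ∀ᶠ r in 𝓝[>] (0 : ℝ), 3 * r < ε := by
        have hc : Continuous fun r : ℝ => 3 * r := by fun_prop
        refine ((hc.tendsto 0).mono_left nhdsWithin_le_nhds).eventually_lt_const ?_
        simpa using hε
      have h2 : ∀ᶠ r in 𝓝[>] (0 : ℝ),
          3 / 2 * r + μ / 8 * (θ * δ + r) ^ 2 < μ / 8 * (θ * δ) ^ 2 + ε := by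
        have hc : Continuous fun r : ℝ => 3 / 2 * r + μ / 8 * (θ * δ + r) ^ 2 := by fun_prop
        refine ((hc.tendsto 0).mono_left nhdsWithin_le_nhds).eventually_lt_const ?_
        simpa using hε
      obtain ⟨r, h3, h4, h5⟩ := (h1.and (h2.and self_mem_nhdsWithin)).exists
      exact ⟨r, h5, h3, h4⟩
    obtain ⟨m, hm, hxm, hmu, hφm⟩ := ih hr0
    obtain ⟨n, hn, hmn, hnu, hφn⟩ := hS.exists_almost_midpoint hφ hμ hD hlen hm hu hr0
    have hsq : dist m u ^ 2 ≤ (θ * δ + r) ^ 2 := by gcongr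
    have hsq' := mul_le_mul_of_nonneg_left hsq (show 0 ≤ μ / 8 by positivity)
    have htri := dist_triangle x m n
    rw [pow_succ]
    refine ⟨n, hn, by linarith, by linarith, ?_⟩
    refine hφn.trans ?_
    linarith

/-- Energy dissipation in one step of the relaxed Minimizing Movement scheme. -/
theorem IsEVIFlow.energy_sub_resolvent_ge (hφ : IsSystem φ) (hμ : 0 ≤ μ)
    (hS : IsEVIFlow φ (-μ) D S) (hD : effDom φ ⊆ D) (hlen : IsApproxLength (effDom φ))
    (hτ : 0 < τ) (hη : 0 ≤ η) {x u : X} (hx : x ∈ effDom φ) (hu : u ∈ resolvent φ τ η x) :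
    (1 / τ - (μ + η) / 2) * dist x u ^ 2 ≤ (φ x).toReal - (φ u).toReal := by
  set δ := dist x u with hδ
  have hδ0 : 0 ≤ δ := dist_nonneg
  -- Test minimality at the dyadic point with `θ = 2^{-k}`, let its error vanish, and divide by `θ`.
  -- The factor `2 - θ` comes from `1 - (1 - θ)²` and yields `1/τ` as `k → ∞`.
  have key : ∀ k : ℕ, 1 / (2 * τ) * (2 - (1 / 2 : ℝ) ^ k) * δ ^ 2
      ≤ (φ x).toReal - (φ u).toReal + μ / 2 * (1 - (1 / 2) ^ k) * δ ^ 2 + η / 2 * δ ^ 2 := by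
    intro k
    have hθ : 0 < (1 / 2 : ℝ) ^ k := by positivity
    have hθ1 : (1 / 2 : ℝ) ^ k ≤ 1 := pow_le_one₀ (by norm_num) (by norm_num)
    have hex := fun ε (hε : (0 : ℝ) < ε) =>
      hS.exists_almost_dyadic_point hφ hμ hD hlen hx hu.1 k hε
    set θ : ℝ := (1 / 2) ^ k
    have h1 : ∀ ε : ℝ, 0 < ε → 1 / (2 * τ) * δ ^ 2 + (φ u).toReal ≤
        1 / (2 * τ) * ((1 - θ) * δ + ε) ^ 2 + ((1 - θ) * (φ u).toReal + θ * (φ x).toReal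
          + μ / 2 * (θ * (1 - θ)) * δ ^ 2 + ε) + η / 2 * δ * (θ * δ + ε) := by
      intro ε hε
      obtain ⟨m, hm, hxm, hmu, hφm⟩ := hex ε hε
      refine (minimality_toReal hφ hu hm).trans ?_
      gcongr
    have h2 : Tendsto (fun ε : ℝ => 1 / (2 * τ) * ((1 - θ) * δ + ε) ^ 2 +
        ((1 - θ) * (φ u).toReal + θ * (φ x).toReal
          + μ / 2 * (θ * (1 - θ)) * δ ^ 2 + ε) + η / 2 * δ * (θ * δ + ε)) (𝓝[>] 0)
        (𝓝 (1 / (2 * τ) * ((1 - θ) * δ + 0) ^ 2 +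
        ((1 - θ) * (φ u).toReal + θ * (φ x).toReal
          + μ / 2 * (θ * (1 - θ)) * δ ^ 2 + 0) + η / 2 * δ * (θ * δ + 0))) := by
      refine Tendsto.mono_left (Continuous.tendsto ?_ 0) nhdsWithin_le_nhds
      fun_prop
    have h3 := ge_of_tendsto h2 (eventually_mem_nhdsWithin.mono h1)
    refine le_of_mul_le_mul_left (a := θ) ?_ hθ
    linarith
  have hpow : Tendsto (fun k : ℕ => (1 / 2 : ℝ) ^ k) atTop (𝓝 0) :=
    tendsto_pow_atTop_nhds_zero_of_lt_one (by norm_num) (by norm_num)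
  have hl := ((tendsto_const_nhds (x := (2 : ℝ))).sub hpow).const_mul (1 / (2 * τ))
    |>.mul_const (δ ^ 2)
  have hr := ((((tendsto_const_nhds (x := (1 : ℝ))).sub hpow).const_mul (μ / 2)
    |>.mul_const (δ ^ 2)).const_add ((φ x).toReal - (φ u).toReal)).add_const (η / 2 * δ ^ 2)
  have := le_of_tendsto_of_tendsto' hl hr key
  have h4 : 1 / (2 * τ) * (2 - 0) * δ ^ 2 = 1 / τ * δ ^ 2 := by
    field_simp
    ring
  rw [h4] at this
  linarith

/-- Minimality and the triangle inequality bound `φ u - φ y` linearly in `d(y,u)`, up to a quadratic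
term absorbed by `ε` near `u`. -/
theorem slope_resolvent_le (hφ : IsSystem φ) (hτ : 0 < τ) {x u : X}
    (hη : 0 ≤ η) (hu : u ∈ resolvent φ τ η x) :
    slope φ u ≤ ENNReal.ofReal ((1 / τ + η / 2) * dist x u) := by
  have key : ∀ ε : ℝ, 0 < ε → slope φ u ≤ ENNReal.ofReal ((1 / τ + η / 2) * dist x u + ε) := by
    intro ε hε
    rw [slope, if_pos (show φ u < ⊤ from hu.1)]
    refine limsup_le_of_le (by isBoundedDefault) ?_
    have hball : ∀ᶠ y in 𝓝[≠] u, dist y u < 2 * τ * ε :=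
      nhdsWithin_le_nhds (Metric.ball_mem_nhds u (by positivity))
    filter_upwards [hball, self_mem_nhdsWithin] with y hy hyu
    have hyu : y ≠ u := hyu
    by_cases hyd : y ∈ effDom φ
    · have h1 := minimality_toReal hφ hu hyd
      rw [ENNReal.div_le_iff (edist_pos.2 hyu.symm).ne' (edist_ne_top _ _), edist_dist,
        ← ENNReal.ofReal_mul (by positivity), ← coe_toReal_of_mem hφ hu.1,
        ← coe_toReal_of_mem hφ hyd, ← EReal.coe_sub,
        EReal.toENNReal_of_ne_top (EReal.coe_ne_top _), EReal.toReal_coe]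
      refine ENNReal.ofReal_le_ofReal ?_
      rw [dist_comm u y]
      have h2 : dist x y ^ 2 ≤ (dist x u + dist y u) ^ 2 := by
        gcongr
        rw [dist_comm y u]
        exact dist_triangle x u y
      have h3 : 1 / (2 * τ) * dist x y ^ 2 ≤ 1 / (2 * τ) * (dist x u + dist y u) ^ 2 := by gcongr
      have h4 : 1 / (2 * τ) * (dist x u + dist y u) ^ 2 = 1 / (2 * τ) * dist x u ^ 2
          + 1 / τ * dist x u * dist y u + dist y u / (2 * τ) * dist y u := by
        field_simp
        ring
      have h5 : dist y u / (2 * τ) ≤ ε := by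
        rw [div_le_iff₀ (by positivity)]
        linarith
      have h6 := mul_le_mul_of_nonneg_right h5 (dist_nonneg (x := y) (y := u))
      linarith
    · have : φ y = ⊤ := by
        simpa [effDom] using hyd
      rw [this]
      simp
  have hlim : Tendsto (fun ε : ℝ => ENNReal.ofReal ((1 / τ + η / 2) * dist x u + ε)) (𝓝[>] 0)
      (𝓝 (ENNReal.ofReal ((1 / τ + η / 2) * dist x u + 0))) := by
    refine (ENNReal.continuous_ofReal.tendsto _).comp
      (Tendsto.mono_left (Continuous.tendsto ?_ 0) nhdsWithin_le_nhds)
    fun_prop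
  simpa using ge_of_tendsto hlim (eventually_mem_nhdsWithin.mono key)

/-- Distance of the flow started at `x` from a point `u` of lower energy. -/
theorem IsEVIFlow.dist_sq_le_of_energy_le (hφ : IsSystem φ) (hμ : 0 ≤ μ)
    (hS : IsEVIFlow φ (-μ) D S) {x u : X} (hx : x ∈ D) (hxd : x ∈ effDom φ) (hu : u ∈ effDom φ)
    {G : ℝ} (hG : 0 ≤ G) (hslope : slope φ x ≤ ENNReal.ofReal G) (hτ : 0 < τ) (hμτ : μ * τ ≤ 1)
    (hP : 0 ≤ (φ x).toReal - (φ u).toReal) :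
    dist (S τ x) u ^ 2 ≤ Real.exp (μ * τ) * (dist x u ^ 2
      - 2 * ((φ x).toReal - (φ u).toReal) * (τ - μ * τ ^ 2 / 2)
      + G ^ 2 * Real.exp (2 * (μ * τ)) * τ ^ 2) := by
  set P := (φ x).toReal - (φ u).toReal with hPdef
  set Q := G ^ 2 * Real.exp (2 * (μ * τ)) with hQ
  have hQ0 : 0 ≤ Q := by positivity
  refine le_of_dini_le (f := fun s => dist (S s x) u ^ 2) (K := μ) (b := τ)
    (g := fun s => -2 * P + 2 * Q * s)
    (B := fun s => Real.exp (μ * s) * (dist x u ^ 2 - 2 * P * (s - μ * s ^ 2 / 2) + Q * s ^ 2))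
    (B' := fun s => Real.exp (μ * s) * μ *
        (dist x u ^ 2 - 2 * P * (s - μ * s ^ 2 / 2) + Q * s ^ 2)
      + Real.exp (μ * s) * (-(2 * P * (1 - μ * (2 * s) / 2)) + Q * (2 * s)))
    (hS.continuousOn_dist_sq hx u τ) ?_ ?_ ?_ ?_ ⟨hτ.le, le_rfl⟩
  · intro s hs r hr
    refine hS.dini hφ hx hu hs.1 (lt_of_le_of_lt ?_ hr)
    have h1 := hS.dist_initial_le hφ hμ hx hxd hG hslope hs.1.le
    have h2 := hS.energy_sub_le hφ hμ hx hxd (hS.mem_effDom hx hs.1) hG hslope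
    set w := μ * s with hw
    have hw0 : 0 ≤ w := mul_nonneg hμ hs.1.le
    have hwz : w ≤ μ * τ := mul_le_mul_of_nonneg_left hs.2.le hμ
    have h3 : (φ x).toReal - (φ (S s x)).toReal ≤
        G * (G * s * Real.exp w) + μ / 2 * (G * s * Real.exp w) ^ 2 := by
      refine h2.trans ?_
      gcongr
    have h4 : G * (G * s * Real.exp w) + μ / 2 * (G * s * Real.exp w) ^ 2
        = G ^ 2 * s * (Real.exp w * (1 + w / 2 * Real.exp w)) := by
      rw [hw]; ring
    -- Since `w ≤ μτ ≤ 1`, `e^w (1 - w/2) ≥ (1 + w)(1 - w/2) ≥ 1`.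
    have h5 : 1 + w / 2 * Real.exp w ≤ Real.exp w := by
      nlinarith [Real.add_one_le_exp w]
    have h6 : Real.exp w * (1 + w / 2 * Real.exp w) ≤ Real.exp (2 * (μ * τ)) := by
      have h7 : Real.exp w * Real.exp w ≤ Real.exp (2 * (μ * τ)) := by
        rw [← Real.exp_add]
        exact Real.exp_le_exp.2 (by linarith)
      exact (mul_le_mul_of_nonneg_left h5 (Real.exp_pos w).le).trans h7
    have h8 := mul_le_mul_of_nonneg_left h6 (show 0 ≤ G ^ 2 * s from
      mul_nonneg (sq_nonneg G) hs.1.le)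
    have h9 : G ^ 2 * s * Real.exp (2 * (μ * τ)) = Q * s := by rw [hQ]; ring
    linarith
  · intro s
    have h1 := ((hasDerivAt_id s).const_mul μ).exp
    have h2 := ((hasDerivAt_id s).fun_pow 2).const_mul μ |>.div_const 2
    have h3 := (((hasDerivAt_id s).fun_sub h2).const_mul (2 * P)).const_sub (dist x u ^ 2)
    have h4 := h3.fun_add (((hasDerivAt_id s).fun_pow 2).const_mul Q)
    simpa using h1.fun_mul h4
  · simp [hS.zero x hx]
  · intro s hs
    have hw0 : 0 ≤ μ * s := mul_nonneg hμ hs.1.le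
    have h1 : Real.exp (μ * s) * (1 - μ * s) ≤ 1 := by
      have h2 := Real.one_sub_le_exp_neg (μ * s)
      have h3 := mul_le_mul_of_nonneg_left h2 (Real.exp_pos (μ * s)).le
      rwa [← Real.exp_add, add_neg_cancel, Real.exp_zero] at h3
    have h4 := mul_le_mul_of_nonneg_left h1 hP
    have h5 := mul_le_mul_of_nonneg_left (Real.one_le_exp hw0)
      (mul_nonneg hQ0 hs.1.le)
    linarith

/-- The local error of the relaxed Minimizing Movement scheme is controlled by the decrease of the
squared slope. -/
theorem IsEVIFlow.dist_sq_resolvent_le (hφ : IsSystem φ) (hμ : 0 ≤ μ)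
    (hS : IsEVIFlow φ (-μ) D S) (hD : effDom φ ⊆ D) (hlen : IsApproxLength (effDom φ))
    (hτ : 0 < τ) (hη : 0 ≤ η) (hsmall : 4 * (2 * η + 3 * μ) * τ ≤ 1) {x u : X}
    (hx : x ∈ effDom φ) (hu : u ∈ resolvent φ τ η x)
    {G : ℝ} (hG : 0 ≤ G) (hslope : slope φ x ≤ ENNReal.ofReal G) :
    dist (S τ x) u ^ 2 ≤ Real.exp (2 * ((2 * η + 3 * μ) * τ)) * τ ^ 2 *
      (G ^ 2 - Real.exp (-(2 * ((2 * η + 3 * μ) * τ))) * ((1 / τ + η / 2) * dist x u) ^ 2) := by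
  set δ := dist x u with hδ
  set z := μ * τ with hz
  set h := η * τ with hh
  have hz0 : 0 ≤ z := mul_nonneg hμ hτ.le
  have hh0 : 0 ≤ h := mul_nonneg hη hτ.le
  have hzh : 4 * (2 * h + 3 * z) ≤ 1 := by rw [hz, hh]; linarith
  have hq : (2 * η + 3 * μ) * τ = 2 * h + 3 * z := by rw [hz, hh]; ring
  have hP := hS.energy_sub_resolvent_ge hφ hμ hD hlen hτ hη hx hu
  have hPτ : (1 - (z + h) / 2) * δ ^ 2 ≤ ((φ x).toReal - (φ u).toReal) * τ := by
    have h1 := mul_le_mul_of_nonneg_right hP hτ.le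
    refine le_trans (le_of_eq ?_) h1
    rw [hz, hh, hδ]
    field_simp
  have hP0 : 0 ≤ (φ x).toReal - (φ u).toReal := by
    have h1 : 0 ≤ (1 - (z + h) / 2) * δ ^ 2 := mul_nonneg (by linarith) (sq_nonneg _)
    exact nonneg_of_mul_nonneg_left (h1.trans hPτ) hτ
  have hmain := hS.dist_sq_le_of_energy_le hφ hμ (hD hx) hx hu.1 hG hslope hτ
    (by rw [← hz]; linarith) hP0
  set P := (φ x).toReal - (φ u).toReal
  rw [← hz, ← hδ] at hmain
  rw [hq]
  have hG' : τ ^ 2 * ((1 / τ + η / 2) * δ) ^ 2 = (1 + h / 2) ^ 2 * δ ^ 2 := by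
    rw [hh]
    field_simp
  -- The doubled dissipation is decisive here: `P τ ≈ δ²` makes the left side close to `-δ²`, which
  -- becomes the negative slope term at `u`.
  have h1 : δ ^ 2 - 2 * P * (τ - μ * τ ^ 2 / 2) ≤ -((1 - (2 * z + h)) * δ ^ 2) := by
    have h2 : 2 * P * (τ - μ * τ ^ 2 / 2) = 2 * (1 - z / 2) * (P * τ) := by rw [hz]; ring
    have h3 := mul_le_mul_of_nonneg_left hPτ (show 0 ≤ 2 * (1 - z / 2) by linarith)
    have h4 : 0 ≤ z * (z + h) / 2 * δ ^ 2 := by positivity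
    rw [h2]
    linarith
  have h2 : Real.exp (-(4 * z + 4 * h)) * (1 + h / 2) ^ 2 ≤ 1 - (2 * z + h) := by
    have h3 : (1 + h / 2) ^ 2 ≤ Real.exp h := by
      have h4 : 1 + h / 2 ≤ Real.exp (h / 2) := by linarith [Real.add_one_le_exp (h / 2)]
      calc (1 + h / 2) ^ 2 ≤ Real.exp (h / 2) ^ 2 := by gcongr
        _ = Real.exp h := by rw [← Real.exp_nat_mul]; congr 1; push_cast; ring
    -- With `w = 2z + h ≤ 1/4` by the step-size condition, this follows from `(1 - w)(1 + 2w) ≥ 1`.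
    have h5 : Real.exp (-(2 * (2 * z + h))) ≤ 1 - (2 * z + h) := by
      have h6 := Real.add_one_le_exp (2 * (2 * z + h))
      rw [Real.exp_neg, inv_le_comm₀ (Real.exp_pos _) (by linarith)]
      refine le_trans ?_ h6
      rw [inv_le_iff_one_le_mul₀ (by linarith)]
      nlinarith
    calc Real.exp (-(4 * z + 4 * h)) * (1 + h / 2) ^ 2
        ≤ Real.exp (-(4 * z + 4 * h)) * Real.exp h := by gcongr
      _ = Real.exp (-(4 * z + 3 * h)) := by rw [← Real.exp_add]; congr 1; ring
      _ ≤ Real.exp (-(2 * (2 * z + h))) := Real.exp_le_exp.2 (by linarith)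
      _ ≤ _ := h5
  have h3 := mul_le_mul_of_nonneg_right h2 (sq_nonneg δ)
  have h4 : Real.exp z * (δ ^ 2 - 2 * P * (τ - μ * τ ^ 2 / 2)) ≤
      -(Real.exp z * Real.exp (-(4 * z + 4 * h)) * ((1 + h / 2) ^ 2 * δ ^ 2)) := by
    have h5 := mul_le_mul_of_nonneg_left
      (show δ ^ 2 - 2 * P * (τ - μ * τ ^ 2 / 2) ≤
        -(Real.exp (-(4 * z + 4 * h)) * (1 + h / 2) ^ 2 * δ ^ 2) by linarith) (Real.exp_pos z).le
    linarith
  have hE : Real.exp z * Real.exp (2 * z) = Real.exp (3 * z) := by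
    rw [← Real.exp_add]; congr 1; ring
  have hE' : Real.exp z * Real.exp (-(4 * z + 4 * h))
      = Real.exp (3 * z) * Real.exp (-(2 * (2 * h + 3 * z))) := by
    rw [← Real.exp_add, ← Real.exp_add]; congr 1; ring
  rw [hE', ← hG'] at h4
  have hb : dist (S τ x) u ^ 2 ≤ Real.exp (3 * z) * (τ ^ 2 *
      (G ^ 2 - Real.exp (-(2 * (2 * h + 3 * z))) * ((1 / τ + η / 2) * δ) ^ 2)) := by
    have h6 : Real.exp z * (G ^ 2 * Real.exp (2 * z) * τ ^ 2)
        = Real.exp (3 * z) * (τ ^ 2 * G ^ 2) := by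
      rw [← hE]; ring
    linarith
  have hb0 : 0 ≤ τ ^ 2 *
      (G ^ 2 - Real.exp (-(2 * (2 * h + 3 * z))) * ((1 / τ + η / 2) * δ) ^ 2) :=
    nonneg_of_mul_nonneg_right ((sq_nonneg _).trans hb) (Real.exp_pos _)
  rw [mul_assoc]
  exact hb.trans (mul_le_mul_of_nonneg_right (Real.exp_le_exp.2 (by linarith)) hb0)

end

/-! ### Accumulation of the local errors -/

/-- The inductive step of Cauchy-Schwarz for a sum of `n + 1` terms: `2ab ≤ A + nB`. -/
theorem add_sq_le_succ_mul {a b A B : ℝ} (n : ℕ) (hB : 0 ≤ B) (hA : 0 ≤ A)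
    (haA : a ^ 2 ≤ n * A) (hbB : b ^ 2 ≤ B) : (a + b) ^ 2 ≤ (n + 1) * (A + B) := by
  have hn : (0 : ℝ) ≤ n := n.cast_nonneg
  have h1 : (a * b) ^ 2 ≤ ((A + n * B) / 2) ^ 2 := by
    have h2 : a ^ 2 * b ^ 2 ≤ n * A * B := mul_le_mul haA hbB (sq_nonneg b) (by positivity)
    nlinarith [sq_nonneg (A - n * B)]
  have h3 := (abs_le_of_sq_le_sq' h1 (by positivity)).2
  nlinarith

section
variable {X : Type*} [MetricSpace X] {φ : X → EReal}
variable {μ τ η : ℝ} {D : Set X} {S : ℝ → X → X}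

/-- Global error estimate at the nodes of the time grid. -/
theorem IsEVIFlow.dist_minimizingMovement_le (hφ : IsSystem φ) (hμ : 0 ≤ μ)
    (hS : IsEVIFlow φ (-μ) D S) (hD : effDom φ ⊆ D) (hlen : IsApproxLength (effDom φ))
    (hτ : 0 < τ) (hη : 0 ≤ η) (hsmall : 4 * (2 * η + 3 * μ) * τ ≤ 1) {U : ℕ → X}
    (hU : IsMinimizingMovement φ τ η U)
    {G : ℝ} (hG : 0 ≤ G) (hslope : slope φ (U 0) ≤ ENNReal.ofReal G) (n : ℕ) :
    dist (S (n * τ) (U 0)) (U n) ≤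
      Real.sqrt n * τ * Real.exp ((2 * η + 3 * μ) * (n * τ)) * G := by
  set q := (2 * η + 3 * μ) * τ with hq
  have hq0 : 0 ≤ q := by positivity
  have hμq : μ * τ ≤ q := mul_le_mul_of_nonneg_right (by linarith) hτ.le
  have hexp : ∀ m : ℕ, Real.exp (2 * q * (m + 1 : ℕ)) = Real.exp (2 * q) * Real.exp (2 * q * m) := by
    intro m
    rw [← Real.exp_add]; congr 1; push_cast; ring
  -- The weights `e^{-2qm}` make the local errors telescope in `g²`. The bound on `g` is propagated
  -- by the local estimate itself, whose right side dominates a square.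
  have key : ∀ m : ℕ, ∃ g : ℝ, 0 ≤ g ∧ slope φ (U m) ≤ ENNReal.ofReal g ∧
      Real.exp (-(2 * q * m)) * g ^ 2 ≤ G ^ 2 ∧
      dist (S (m * τ) (U 0)) (U m) ^ 2 ≤
        m * (τ ^ 2 * Real.exp (2 * q * m) * (G ^ 2 - Real.exp (-(2 * q * m)) * g ^ 2)) := by
    intro m
    induction m with
    | zero => exact ⟨G, hG, hslope, by simp, by simp [hS.zero (U 0) (hD (hU.mem 0))]⟩
    | succ m ih =>
      obtain ⟨g, hg0, hg, hgG, hd⟩ := ih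
      have hlocal := hS.dist_sq_resolvent_le hφ hμ hD hlen hτ hη hsmall (hU.mem m) (hU.step m)
        hg0 hg
      rw [← hq] at hlocal
      have hg' := slope_resolvent_le hφ hτ hη (hU.step m)
      set g' := (1 / τ + η / 2) * dist (U m) (U (m + 1)) with hg'def
      have hg'0 : 0 ≤ g' := by positivity
      have h1 : Real.exp (2 * q * m) * Real.exp (-(2 * q * m)) = 1 := by
        rw [← Real.exp_add]; simp
      have h1' : Real.exp (-(2 * q * (m + 1 : ℕ)))
          = Real.exp (-(2 * q)) * Real.exp (-(2 * q * m)) := by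
        rw [← Real.exp_add]; congr 1; push_cast; ring
      have hloc : dist (S τ (U m)) (U (m + 1)) ^ 2 ≤ τ ^ 2 * Real.exp (2 * q * (m + 1 : ℕ)) *
          (Real.exp (-(2 * q * m)) * g ^ 2 - Real.exp (-(2 * q * (m + 1 : ℕ))) * g' ^ 2) := by
        refine hlocal.trans (le_of_eq ?_)
        rw [hexp, h1']
        linear_combination (-(τ ^ 2 * Real.exp (2 * q) *
          (g ^ 2 - Real.exp (-(2 * q)) * g' ^ 2))) * h1
      have hloc0 := nonneg_of_mul_nonneg_right ((sq_nonneg _).trans hloc) (by positivity)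
      have hstep : dist (S ((m + 1 : ℕ) * τ) (U 0)) (U (m + 1)) ≤
          Real.exp q * dist (S (m * τ) (U 0)) (U m) + dist (S τ (U m)) (U (m + 1)) := by
        have h2 : S ((m + 1 : ℕ) * τ) (U 0) = S τ (S (m * τ) (U 0)) := by
          rw [← hS.semigroup _ (hD (hU.mem 0)) _ _ (by positivity) hτ.le]
          congr 1; push_cast; ring
        have h3 := hS.dist_le hφ (hS.mapsTo (m * τ) (by positivity) (hD (hU.mem 0)))
          (hD (hU.mem m)) hτ.le
        have h4 : Real.exp (μ * τ) * dist (S (m * τ) (U 0)) (U m) ≤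
            Real.exp q * dist (S (m * τ) (U 0)) (U m) := by gcongr
        rw [h2]
        exact (dist_triangle _ (S τ (U m)) _).trans (by linarith)
      refine ⟨g', hg'0, hg', by linarith, ?_⟩
      have h5 : (Real.exp q * dist (S (m * τ) (U 0)) (U m)) ^ 2 ≤ m * (τ ^ 2 *
          Real.exp (2 * q * (m + 1 : ℕ)) * (G ^ 2 - Real.exp (-(2 * q * m)) * g ^ 2)) := by
        have h6 : Real.exp q ^ 2 = Real.exp (2 * q) := by
          rw [← Real.exp_nat_mul]; congr 1
        rw [mul_pow, h6, hexp]
        refine (mul_le_mul_of_nonneg_left hd (Real.exp_pos _).le).trans (le_of_eq ?_)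
        ring
      have h7 := add_sq_le_succ_mul m
        (mul_nonneg (by positivity) hloc0) (mul_nonneg (by positivity) (sub_nonneg.2 hgG)) h5 hloc
      refine (pow_le_pow_left₀ dist_nonneg hstep 2).trans (h7.trans (le_of_eq ?_))
      push_cast
      ring
  obtain ⟨g, -, -, -, hd⟩ := key n
  have h1 : dist (S (n * τ) (U 0)) (U n) ^ 2 ≤
      (Real.sqrt n * τ * Real.exp ((2 * η + 3 * μ) * (n * τ)) * G) ^ 2 := by
    refine hd.trans ?_
    have h2 : Real.exp ((2 * η + 3 * μ) * (n * τ)) ^ 2 = Real.exp (2 * q * n) := by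
      rw [← Real.exp_nat_mul]; congr 1; rw [hq]; push_cast; ring
    rw [mul_pow, mul_pow, mul_pow, h2, Real.sq_sqrt n.cast_nonneg]
    have h3 : G ^ 2 - Real.exp (-(2 * q * n)) * g ^ 2 ≤ G ^ 2 := sub_le_self _ (by positivity)
    refine (mul_le_mul_of_nonneg_left (mul_le_mul_of_nonneg_left h3 (by positivity))
      n.cast_nonneg).trans (le_of_eq ?_)
    ring
  exact (abs_le_of_sq_le_sq' h1 (by positivity)).2

/-- Splitting `S t x` as `S s (S (t - s) x)` reduces to the displacement from `x`, transported by
contractivity, so no slope bound at `S s x` is required. -/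
theorem IsEVIFlow.dist_add_le (hφ : IsSystem φ) (hμ : 0 ≤ μ)
    (hS : IsEVIFlow φ (-μ) D S) {x : X} (hx : x ∈ D) (hxd : x ∈ effDom φ)
    {G : ℝ} (hG : 0 ≤ G) (hslope : slope φ x ≤ ENNReal.ofReal G) {s t : ℝ} (hs : 0 ≤ s)
    (hst : s ≤ t) : dist (S s x) (S t x) ≤ (t - s) * Real.exp (μ * t) * G := by
  have hr : 0 ≤ t - s := sub_nonneg.2 hst
  have h1 : S t x = S s (S (t - s) x) := by
    rw [← hS.semigroup x hx (t - s) s hr hs, sub_add_cancel]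
  rw [h1]
  refine (hS.dist_le hφ hx (hS.mapsTo _ hr hx) hs).trans ?_
  rw [dist_comm]
  refine (mul_le_mul_of_nonneg_left (hS.dist_initial_le hφ hμ hx hxd hG hslope hr)
    (Real.exp_pos _).le).trans (le_of_eq ?_)
  have h2 : Real.exp (μ * t) = Real.exp (μ * s) * Real.exp (μ * (t - s)) := by
    rw [← Real.exp_add]; congr 1; ring
  rw [h2]
  ring

/-- Error estimate for the relaxed Minimizing Movement scheme. -/
theorem IsEVIFlow.edist_interpolant_le (hφ : IsSystem φ) (hμ : 0 ≤ μ)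
    (hS : IsEVIFlow φ (-μ) D S) (hD : effDom φ ⊆ D) (hlen : IsApproxLength (effDom φ))
    (hτ : 0 < τ) (hη : 0 ≤ η) (hsmall : 4 * (2 * η + 3 * μ) * τ ≤ 1) {U : ℕ → X}
    (hU : IsMinimizingMovement φ τ η U) {u₀ : X} (hu₀ : u₀ ∈ D) {t : ℝ} (ht : 0 < t) :
    edist (S t u₀) (interpolant τ U t) ≤ ENNReal.ofReal (Real.exp (μ * t)) * edist u₀ (U 0)
      + ENNReal.ofReal ((Real.sqrt (τ * gridCeil τ t) + gridCeil τ t - t)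
          * Real.exp ((2 * η + 3 * μ) * gridCeil τ t)) * slope φ (U 0) := by
  have hT : t ≤ gridCeil τ t := (isLeast_gridCeil hτ t).1.choose_spec.2
  have hT0 : 0 < gridCeil τ t := ht.trans_le hT
  have hsq : 0 < Real.sqrt (τ * gridCeil τ t) := Real.sqrt_pos.2 (mul_pos hτ hT0)
  have hc : 0 < (Real.sqrt (τ * gridCeil τ t) + gridCeil τ t - t)
      * Real.exp ((2 * η + 3 * μ) * gridCeil τ t) := mul_pos (by linarith) (Real.exp_pos _)
  -- The coefficient of the slope is strictly positive, so the convention `0 * ⊤ = 0` cannot spoil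
  -- the infinite case.
  rcases eq_or_ne (slope φ (U 0)) ⊤ with htop | htop
  · rw [htop, ENNReal.mul_top (ENNReal.ofReal_pos.2 hc).ne', add_top]
    exact le_top
  set G := (slope φ (U 0)).toReal with hGdef
  have hG : 0 ≤ G := ENNReal.toReal_nonneg
  have hGs : slope φ (U 0) = ENNReal.ofReal G := (ENNReal.ofReal_toReal htop).symm
  rw [hGs, edist_dist, edist_dist, ← ENNReal.ofReal_mul (Real.exp_pos _).le,
    ← ENNReal.ofReal_mul hc.le, ← ENNReal.ofReal_add (by positivity) (by positivity)]
  refine ENNReal.ofReal_le_ofReal ?_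
  have hU0 := hD (hU.mem 0)
  have h1 := hS.dist_le hφ hu₀ hU0 ht.le
  have h2 := hS.dist_add_le hφ hμ hU0 (hU.mem 0) hG hGs.le ht.le hT
  have h3 := hS.dist_minimizingMovement_le hφ hμ hD hlen hτ hη hsmall hU hG hGs.le ⌈t / τ⌉₊
  have h4 : Real.sqrt (τ * gridCeil τ t) = Real.sqrt (⌈t / τ⌉₊ : ℝ) * τ := by
    rw [gridCeil, mul_comm, mul_assoc, Real.sqrt_mul (Nat.cast_nonneg _), Real.sqrt_mul_self hτ.le]
  change _ ≤ _ * Real.exp ((2 * η + 3 * μ) * gridCeil τ t) * G at h3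
  change dist (S (gridCeil τ t) (U 0)) (interpolant τ U t) ≤ _ at h3
  rw [← h4] at h3
  have h5 : (gridCeil τ t - t) * Real.exp (μ * gridCeil τ t) * G ≤
      (gridCeil τ t - t) * Real.exp ((2 * η + 3 * μ) * gridCeil τ t) * G := by
    have : μ ≤ 2 * η + 3 * μ := by linarith
    have : 0 ≤ gridCeil τ t - t := sub_nonneg.2 hT
    gcongr
  have h6 := dist_triangle4 (S t u₀) (S t (U 0)) (S (gridCeil τ t) (U 0)) (interpolant τ U t)
  linarith

end

end MetricEVI

theorem corollary5p6 {X : Type*} [MetricSpace X] (φ : X → EReal) (hφ : MetricEVI.IsSystem φ)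
    (hlen : MetricEVI.IsApproxLength (MetricEVI.effDom φ))
    (lam : ℝ) (hlam : lam ≤ 0) (S : ℝ → X → X)
    (hS : MetricEVI.IsEVIFlow φ lam (closure (MetricEVI.effDom φ)) S) :
    (∀ τ η : ℝ, 0 < τ → 0 ≤ η → 4 * (2 * η - 3 * lam) * τ ≤ 1 →
      ∀ U : ℕ → X, MetricEVI.IsMinimizingMovement φ τ η U →
      ∀ u₀ ∈ closure (MetricEVI.effDom φ), ∀ t : ℝ, 0 < t →
        edist (S t u₀) (MetricEVI.interpolant τ U t) ≤
          ENNReal.ofReal (Real.exp (-lam * t)) * edist u₀ (U 0)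
          + ENNReal.ofReal ((Real.sqrt (τ * MetricEVI.gridCeil τ t) + MetricEVI.gridCeil τ t - t)
              * Real.exp ((2 * η - 3 * lam) * MetricEVI.gridCeil τ t))
            * MetricEVI.slope φ (U 0)) ∧
    (lam = 0 → ∀ t : ℝ, 0 < t → ∀ n : ℕ, 0 < n →
      ∀ U : ℕ → X, MetricEVI.IsMinimizingMovement φ (t / n) 0 U →
        edist (S t (U 0)) (U n) ≤ ENNReal.ofReal (t / Real.sqrt n) * MetricEVI.slope φ (U 0)) := by
  obtain ⟨μ, rfl⟩ : ∃ μ, lam = -μ := ⟨-lam, (neg_neg lam).symm⟩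
  have hμ : 0 ≤ μ := neg_nonpos.1 hlam
  have h3 : ∀ η : ℝ, 2 * η - 3 * -μ = 2 * η + 3 * μ := fun η => by ring
  simp only [h3, neg_neg]
  refine ⟨fun τ η hτ hη hsmall U hU u₀ hu₀ t ht =>
    hS.edist_interpolant_le hφ hμ subset_closure hlen hτ hη hsmall hU hu₀ ht,
    fun hμ0 t ht n hn U hU => ?_⟩
  obtain rfl : μ = 0 := neg_eq_zero.1 hμ0
  have hn0 : (0 : ℝ) < n := Nat.cast_pos.2 hn
  have h := hS.edist_interpolant_le hφ le_rfl subset_closure hlen (div_pos ht hn0) le_rfl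
    (by simp) hU (subset_closure (hU.mem 0)) ht
  -- For step `t / n`, the time `t` is exactly the `n`-th node, so `t_τ - t` vanishes and only the
  -- square-root term survives.
  have hceil : ⌈t / (t / n)⌉₊ = n := by
    rw [div_div_cancel₀ ht.ne', Nat.ceil_natCast]
  have hgrid : MetricEVI.gridCeil (t / n) t = t := by
    rw [MetricEVI.gridCeil, hceil, mul_div_cancel₀ _ hn0.ne']
  have hint : MetricEVI.interpolant (t / n) U t = U n := by
    rw [MetricEVI.interpolant, hceil]
  have hsqrt : Real.sqrt (t / n * t) = t / Real.sqrt n := by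
    rw [div_mul_eq_mul_div, Real.sqrt_div (by positivity), Real.sqrt_mul_self ht.le]
  rw [hgrid, hint, hsqrt] at h
  simpa using h
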